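/- Let $A,Q\in\mathbb{R}^{n\times n}$, $C\in\mathbb{R}^{1\times n}$ and $\gamma>0$, and consider the time-invariant state space model with scalar output $$x_{k+1}=Ax_k+\omega_k,\qquad y_k=Cx_k+e_k,\qquad k=1,2,\dots,$$ where $x_1$ has mean $\mu$ and covariance $P_0$, $\omega_k$ has mean $0$ and covariance $Q$, $e_k$ has mean $0$ and variance $\gamma$, and $x_1$ and all the $\omega_k,e_k$ are square integrable and mutually uncorrelated. Assume that the model is stabilizable and detectable: writing $Q=BB^T$ with $B\in\mathbb{R}^{n\times n}$, there are matrices $F$ and $L$ such that all eigenvalues of $A-BF$ and of $A-LC$ lie strictly inside the unit circle. For $t\ge 1$ let $X_t=[x_1^T\,\dots\,x_t^T]^T$, $Y_t=[y_1\,\dots\,y_t]^T$, $O_t=\mathrm{diag}\{C,\dots,C\}$ ($t$ blocks), let $H_t=O_t\,\mathrm{Var}(X_t)\,O_t^T\,\mathrm{Var}(Y_t)^{-1}$ be the influence matrix (which maps the centred outputs to their optimal linear smoothed estimate), and let $\delta_t=\mathrm{Tr}(H_t)$ be the degrees of freedom. Define $P_1=P_0$, $\Sigma_1=0$ and, for $k\ge1$,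 with $K_k=AP_kC^T(CP_kC^T+\gamma)^{-1}$, $$P_{k+1}=(A-K_kC)P_k(A-K_kC)^T+\gamma K_kK_k^T+Q,\qquad \Sigma_{k+1}=(A-K_kC)\Sigma_k(A-K_kC)^T+K_kK_k^T .$$ Then the algebraic Riccati equation $$\bar P=A\bar PA^T+Q-A\bar PC^T(C\bar PC^T+\gamma)^{-1}C\bar PA^T$$ has a unique symmetric positive semidefinite solution $\bar P$; with $\bar K=A\bar PC^T(C\bar PC^T+\gamma)^{-1}$, the Lyapunov equation $$\bar\Sigma=(A-\bar KC)\bar\Sigma(A-\bar KC)^T+\bar K\bar K^T$$ has a unique symmetric positive semidefinite solution $\bar\Sigma$; moreover $P_k\to\bar P$ and $\Sigma_k\to\bar\Sigma$ as $k\to\infty$, and the asymptotic smoothing ratio is $$\lim_{k\to\infty}\frac{\delta_k}{k}=1-\gamma\,\frac{C\bar\Sigma C^T+1}{C\bar PC^T+\gamma}.$$ -/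

import Mathlib

open MeasureTheory ProbabilityTheory Filter Topology
open scoped Matrix

namespace GCVFilter

/-- All (complex) eigenvalues of the real square matrix `A` lie strictly inside the unit circle. -/
def SchurStable {n : ℕ} (A : Matrix (Fin n) (Fin n) ℝ) : Prop :=
  ∀ z ∈ spectrum ℂ (A.map (algebraMap ℝ ℂ)), ‖z‖ < 1

/-- The pair `(A, B)` is stabilizable: `A - B F` is stable for some feedback gain `F`. -/
def Stabilizable {n m : ℕ} (A : Matrix (Fin n) (Fin n) ℝ) (B : Matrix (Fin n) (Fin m) ℝ) : Prop :=
  ∃ F : Matrix (Fin m) (Fin n) ℝ, SchurStable (A - B * F)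

/-- The pair `(C, A)`, with `C` a row vector, is detectable: `A - L C` is stable for some output
injection gain `L` (a column vector). -/
def Detectable {n : ℕ} (A : Matrix (Fin n) (Fin n) ℝ) (C : Fin n → ℝ) : Prop :=
  ∃ L : Fin n → ℝ, SchurStable (A - Matrix.vecMulVec L C)

/-- The scalar `C P Cᵀ` for a row vector `C`. -/
def outputVar {n : ℕ} (C : Fin n → ℝ) (P : Matrix (Fin n) (Fin n) ℝ) : ℝ :=
  C ⬝ᵥ (P *ᵥ C)

/-- The gain `K = A P Cᵀ (C P Cᵀ + γ)⁻¹`, a column vector. -/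
noncomputable def gain {n : ℕ} (A : Matrix (Fin n) (Fin n) ℝ) (C : Fin n → ℝ) (γ : ℝ)
    (P : Matrix (Fin n) (Fin n) ℝ) : Fin n → ℝ :=
  (outputVar C P + γ)⁻¹ • ((A * P) *ᵥ C)

/-- The closed-loop matrix `A - K C`, where `K = A P Cᵀ (C P Cᵀ + γ)⁻¹`. -/
noncomputable def closedLoop {n : ℕ} (A : Matrix (Fin n) (Fin n) ℝ) (C : Fin n → ℝ) (γ : ℝ)
    (P : Matrix (Fin n) (Fin n) ℝ) : Matrix (Fin n) (Fin n) ℝ :=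
  A - Matrix.vecMulVec (gain A C γ P) C

/-- The covariances of the one-step-ahead Kalman prediction, started at `P₀`:
`P ↦ (A - K C) P (A - K C)ᵀ + γ K Kᵀ + Q`. Index `k` here is time `k + 1`. -/
noncomputable def predCov {n : ℕ} (A : Matrix (Fin n) (Fin n) ℝ) (C : Fin n → ℝ)
    (Q : Matrix (Fin n) (Fin n) ℝ) (γ : ℝ) (P₀ : Matrix (Fin n) (Fin n) ℝ) :
    ℕ → Matrix (Fin n) (Fin n) ℝ
  | 0 => P₀
  | k + 1 =>
      closedLoop A C γ (predCov A C Q γ P₀ k) * predCov A C Q γ P₀ k *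
          (closedLoop A C γ (predCov A C Q γ P₀ k))ᵀ
        + γ • Matrix.vecMulVec (gain A C γ (predCov A C Q γ P₀ k))
            (gain A C γ (predCov A C Q γ P₀ k))
        + Q

/-- The matrices `Σ_k` of the GCV filter, started at `0`:
`Σ ↦ (A - K C) Σ (A - K C)ᵀ + K Kᵀ`. Index `k` here is time `k + 1`. -/
noncomputable def gcvSigma {n : ℕ} (A : Matrix (Fin n) (Fin n) ℝ) (C : Fin n → ℝ)
    (Q : Matrix (Fin n) (Fin n) ℝ) (γ : ℝ) (P₀ : Matrix (Fin n) (Fin n) ℝ) :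
    ℕ → Matrix (Fin n) (Fin n) ℝ
  | 0 => 0
  | k + 1 =>
      closedLoop A C γ (predCov A C Q γ P₀ k) * gcvSigma A C Q γ P₀ k *
          (closedLoop A C γ (predCov A C Q γ P₀ k))ᵀ
        + Matrix.vecMulVec (gain A C γ (predCov A C Q γ P₀ k))
            (gain A C γ (predCov A C Q γ P₀ k))

/-- `P` is a symmetric positive semidefinite solution of the algebraic Riccati equation
`P = A P Aᵀ + Q - A P Cᵀ (C P Cᵀ + γ)⁻¹ C P Aᵀ`. -/
def IsRiccatiSolution {n : ℕ} (A : Matrix (Fin n) (Fin n) ℝ) (C : Fin n → ℝ)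
    (Q : Matrix (Fin n) (Fin n) ℝ) (γ : ℝ) (P : Matrix (Fin n) (Fin n) ℝ) : Prop :=
  P.PosSemidef ∧
    P = A * P * Aᵀ + Q
      - (outputVar C P + γ)⁻¹ • Matrix.vecMulVec ((A * P) *ᵥ C) (C ᵥ* (P * Aᵀ))

/-- `S` is a symmetric positive semidefinite solution of the Lyapunov equation
`S = (A - K C) S (A - K C)ᵀ + K Kᵀ`, where `K = A P Cᵀ (C P Cᵀ + γ)⁻¹`. -/
def IsLyapunovSolution {n : ℕ} (A : Matrix (Fin n) (Fin n) ℝ) (C : Fin n → ℝ) (γ : ℝ)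
    (P S : Matrix (Fin n) (Fin n) ℝ) : Prop :=
  S.PosSemidef ∧
    S = closedLoop A C γ P * S * (closedLoop A C γ P)ᵀ
      + Matrix.vecMulVec (gain A C γ P) (gain A C γ P)

/-- The time-invariant state space model
`x_{k+1} = A x_k + w_k`, `y_k = C x_k + e_k`, with `x_1 ∼ (m, P₀)`, `w_k ∼ (0, Q)`, `e_k ∼ (0, γ)`
(mean, covariance) square integrable and mutually uncorrelated.
Index `k` here is time `k + 1`, so that `x 0` is the initial state. -/
structure IsStateSpaceModel {Ω : Type*} [MeasurableSpace Ω] (μ : Measure Ω) {n : ℕ}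
    (A : Matrix (Fin n) (Fin n) ℝ) (C : Fin n → ℝ) (Q : Matrix (Fin n) (Fin n) ℝ) (γ : ℝ)
    (m : Fin n → ℝ) (P₀ : Matrix (Fin n) (Fin n) ℝ)
    (x w : ℕ → Ω → Fin n → ℝ) (e y : ℕ → Ω → ℝ) : Prop where
  state : ∀ k, ∀ᵐ s ∂μ, x (k + 1) s = A *ᵥ x k s + w k s
  output : ∀ k, ∀ᵐ s ∂μ, y k s = C ⬝ᵥ x k s + e k s
  memLp_init : ∀ i, MemLp (fun s => x 0 s i) 2 μ
  memLp_w : ∀ k i, MemLp (fun s => w k s i) 2 μ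
  memLp_e : ∀ k, MemLp (e k) 2 μ
  mean_init : ∀ i, ∫ s, x 0 s i ∂μ = m i
  mean_w : ∀ k i, ∫ s, w k s i ∂μ = 0
  mean_e : ∀ k, ∫ s, e k s ∂μ = 0
  cov_init : ∀ i j, cov[fun s => x 0 s i, fun s => x 0 s j; μ] = P₀ i j
  cov_w : ∀ k i j, cov[fun s => w k s i, fun s => w k s j; μ] = Q i j
  cov_e : ∀ k, cov[e k, e k; μ] = γ
  uncorr_init_w : ∀ k i j, cov[fun s => x 0 s i, fun s => w k s j; μ] = 0
  uncorr_init_e : ∀ k i, cov[fun s => x 0 s i, e k; μ] = 0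
  uncorr_w_e : ∀ k l i, cov[fun s => w k s i, e l; μ] = 0
  uncorr_w : ∀ k l, k ≠ l → ∀ i j, cov[fun s => w k s i, fun s => w l s j; μ] = 0
  uncorr_e : ∀ k l, k ≠ l → cov[e k, e l; μ] = 0

/-- `W_t = Var(X_t)`, the covariance matrix of the first `t` states stacked in one vector. -/
noncomputable def stateCov {Ω : Type*} [MeasurableSpace Ω] (μ : Measure Ω) {n : ℕ}
    (x : ℕ → Ω → Fin n → ℝ) (t : ℕ) : Matrix (Fin t × Fin n) (Fin t × Fin n) ℝ :=
  Matrix.of fun a b => cov[fun s => x a.1 s a.2, fun s => x b.1 s b.2; μ]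

/-- `V_t = Var(Y_t)`, the covariance matrix of the first `t` outputs. -/
noncomputable def outputCov {Ω : Type*} [MeasurableSpace Ω] (μ : Measure Ω)
    (y : ℕ → Ω → ℝ) (t : ℕ) : Matrix (Fin t) (Fin t) ℝ :=
  Matrix.of fun k l => cov[y k, y l; μ]

/-- The regression matrix `O_t = diag(C, …, C)` with `t` blocks. -/
def regressionMatrix {n : ℕ} (C : Fin n → ℝ) (t : ℕ) : Matrix (Fin t) (Fin t × Fin n) ℝ :=
  Matrix.of fun k a => if k = a.1 then C a.2 else 0

/-- The influence matrix `H_t = O_t W_t O_tᵀ V_t⁻¹`, which maps the (centred) outputs `Y_t` to their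
optimal linear (smoothed) estimate. -/
noncomputable def influenceMatrix {Ω : Type*} [MeasurableSpace Ω] (μ : Measure Ω) {n : ℕ}
    (C : Fin n → ℝ) (x : ℕ → Ω → Fin n → ℝ) (y : ℕ → Ω → ℝ) (t : ℕ) :
    Matrix (Fin t) (Fin t) ℝ :=
  regressionMatrix C t * stateCov μ x t * (regressionMatrix C t)ᵀ * (outputCov μ y t)⁻¹

/-- The degrees of freedom `δ_t = Tr(H_t)`. -/
noncomputable def degreesOfFreedom {Ω : Type*} [MeasurableSpace Ω] (μ : Measure Ω) {n : ℕ}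
    (C : Fin n → ℝ) (x : ℕ → Ω → Fin n → ℝ) (y : ℕ → Ω → ℝ) (t : ℕ) : ℝ :=
  (influenceMatrix μ C x y t).trace

end GCVFilter

/-! Write V for `Var(Y_t)`. Since V is `O_t Var(X_t) O_tᵀ` plus γI, the influence matrix is I - γV⁻¹
and δ_t = t - γ Tr V⁻¹. The Kalman filter factors V: the unit lower triangular W that turns outputs
into innovations satisfies W V Wᵀ = D, diagonal with entries C P_k Cᵀ + γ
(`whitening_mul_mul_transpose`). Hence Tr V⁻¹ = Tr(Wᵀ D⁻¹ W) sums the squared norms of the rows of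
W, each divided by its entry of D. These norms are C Σ_k Cᵀ + 1, because Σ_k is the sum of outer
products of the prediction coefficients (`gcvSigma_eq_sum`, `sum_sq_whitening`). So δ_t/t is a
Cesàro mean of terms depending only on P_k and Σ_k.

It remains to prove convergence. The Riccati map is the minimum over gains K of the monotone affine
maps P ↦ (A - KC)P(A - KC)ᵀ + γKKᵀ + Q, hence is itself monotone. Its trajectory from 0 increases,
is bounded by detectability, and so tends to a fixed point. Stabilizability makes the closed loop
stable there (`schurStable_closedLoop`). Freezing the gain of the fixed point then gives upper
trajectories with the same limit, and every trajectory is squeezed in between; this also yields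
uniqueness. Finally Σ_k obeys a Lyapunov recursion whose coefficients converge to stable ones
(`tendsto_lyapunov_recursion`). -/

namespace GCVFilter

/-! ### Perturbed linear recursions in a normed space. -/

/-- A nonnegative sequence that is eventually contracted up to a vanishing error tends to zero. -/
theorem tendsto_zero_of_le_mul_add {c η : ℕ → ℝ} {r : ℝ} (hc : ∀ k, 0 ≤ c k) (hr₀ : 0 ≤ r)
    (hr : r < 1) (hη : Tendsto η atTop (𝓝 0)) (h : ∀ᶠ k in atTop, c (k + 1) ≤ r * c k + η k) :
    Tendsto c atTop (𝓝 0) := by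
  rw [Metric.tendsto_atTop]
  intro ε hε
  -- With errors below this threshold, ε / 2 is the fixed point of the worst-case recursion.
  have hη' : ∀ᶠ k in atTop, η k < (1 - r) * (ε / 2) :=
    hη.eventually (gt_mem_nhds (by have := sub_pos.2 hr; positivity))
  obtain ⟨N, hN⟩ := eventually_atTop.1 (h.and hη')
  have key : ∀ j, c (N + j) ≤ r ^ j * c N + ε / 2 := by
    intro j
    induction j with
    | zero => simp; positivity
    | succ j ih =>
      obtain ⟨h1, h2⟩ := hN (N + j) (by omega)
      have h3 := mul_le_mul_of_nonneg_left ih hr₀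
      calc c (N + (j + 1)) ≤ r * c (N + j) + η (N + j) := h1
        _ ≤ r * (r ^ j * c N + ε / 2) + (1 - r) * (ε / 2) := by linarith
        _ = r ^ (j + 1) * c N + ε / 2 := by ring
  have hlim : Tendsto (fun j => r ^ j * c N) atTop (𝓝 0) := by
    simpa using (tendsto_pow_atTop_nhds_zero_of_lt_one hr₀ hr).mul_const (c N)
  obtain ⟨M, hM⟩ := eventually_atTop.1 (hlim.eventually (gt_mem_nhds (half_pos hε)))
  refine ⟨N + M, fun k hk => ?_⟩
  obtain ⟨j, rfl⟩ : ∃ j, k = N + j := ⟨k - N, by omega⟩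
  have h1 := key j
  have h2 := hM j (by omega)
  rw [Real.dist_eq, sub_zero, abs_of_nonneg (hc _)]
  linarith

/-- A linear recursion whose transition operators converge to a power-summable operator and whose
inputs vanish tends to zero. -/
theorem tendsto_zero_of_linear_recursion {E : Type*} [NormedAddCommGroup E] [NormedSpace ℝ E]
    {T : E →L[ℝ] E} (hT : Summable fun j => ‖T ^ j‖) {S : ℕ → E →L[ℝ] E}
    (hS : Tendsto S atTop (𝓝 T)) {x u : ℕ → E} (hu : Tendsto u atTop (𝓝 0))
    (hx : ∀ k, x (k + 1) = S k (x k) + u k) : Tendsto x atTop (𝓝 0) := by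
  have hle : ∀ v j, ‖(T ^ j) v‖ ≤ ‖T ^ j‖ * ‖v‖ := fun v j => (T ^ j).le_opNorm v
  have hsum : ∀ v, Summable fun j => ‖(T ^ j) v‖ := fun v =>
    Summable.of_nonneg_of_le (fun _ => norm_nonneg _) (hle v) (hT.mul_right _)
  -- `N` is an adapted norm, equivalent to the original one. It satisfies `N (T v) = N v - ‖v‖ ≤ (1
  -- - 1 / M) * N v`, so `T` contracts it even when `‖T‖ ≥ 1`.
  obtain ⟨N, hN⟩ : ∃ N : E → ℝ, ∀ v, N v = ∑' j, ‖(T ^ j) v‖ := ⟨_, fun _ => rfl⟩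
  obtain ⟨M, hM1, hM⟩ : ∃ M : ℝ, 1 ≤ M ∧ ∀ v, N v ≤ M * ‖v‖ := by
    refine ⟨max 1 (∑' j, ‖T ^ j‖), le_max_left _ _, fun v => ?_⟩
    rw [hN]
    calc ∑' j, ‖(T ^ j) v‖ ≤ ∑' j, ‖T ^ j‖ * ‖v‖ := (hsum v).tsum_le_tsum (hle v) (hT.mul_right _)
      _ = (∑' j, ‖T ^ j‖) * ‖v‖ := tsum_mul_right
      _ ≤ _ := by gcongr; exact le_max_right _ _
  have hNT : ∀ v, N v = ‖v‖ + N (T v) := by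
    intro v
    rw [hN, hN, (hsum v).tsum_eq_zero_add]
    simp [pow_succ]
  have hNn : ∀ v, 0 ≤ N v := fun v => by rw [hN]; exact tsum_nonneg fun _ => norm_nonneg _
  have hNadd : ∀ v w, N (v + w) ≤ N v + N w := by
    intro v w
    rw [hN, hN, hN, ← (hsum v).tsum_add (hsum w)]
    refine (hsum _).tsum_le_tsum (fun j => ?_) ((hsum v).add (hsum w))
    rw [map_add]
    exact norm_add_le _ _
  have hge : ∀ v, ‖v‖ ≤ N v := fun v => by rw [hNT]; linarith [hNn (T v)]
  have hMpos : 0 < M := by linarith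
  -- A perturbation of this size costs at most half of the gain `‖v‖`, which leaves the contraction
  -- factor `1 - 1 / (2 * M)`.
  have hclose : ∀ᶠ k in atTop, ‖S k - T‖ < 1 / (2 * M) := by
    have := tendsto_iff_norm_sub_tendsto_zero.1 hS
    exact this.eventually (gt_mem_nhds (by positivity))
  have hlim : Tendsto (fun k => N (x k)) atTop (𝓝 0) := by
    refine tendsto_zero_of_le_mul_add (r := 1 - 1 / (2 * M)) (η := fun k => M * ‖u k‖)
      (fun k => hNn _) ?_ ?_ ?_ ?_
    · rw [sub_nonneg, div_le_one (by positivity)]; linarith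
    · have : 0 < 1 / (2 * M) := by positivity
      linarith
    · simpa using hu.norm.const_mul M
    · filter_upwards [hclose] with k hk
      have h1 : x (k + 1) = (T (x k) + (S k - T) (x k)) + u k := by
        rw [hx]; simp
      have h2 : N ((S k - T) (x k)) ≤ 1 / 2 * ‖x k‖ := by
        calc N ((S k - T) (x k)) ≤ M * ‖(S k - T) (x k)‖ := hM _
          _ ≤ M * (1 / (2 * M) * ‖x k‖) := by
              gcongr
              exact ((S k - T).le_opNorm _).trans (by gcongr)
          _ = 1 / 2 * ‖x k‖ := by field_simp
      have h3 : 1 / (2 * M) * N (x k) ≤ 1 / 2 * ‖x k‖ := by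
        calc 1 / (2 * M) * N (x k) ≤ 1 / (2 * M) * (M * ‖x k‖) := by gcongr; exact hM _
          _ = 1 / 2 * ‖x k‖ := by field_simp
      have h4 := hNT (x k)
      rw [h1]
      linarith [hNadd (T (x k) + (S k - T) (x k)) (u k), hNadd (T (x k)) ((S k - T) (x k)),
        hM (u k)]
  exact squeeze_zero_norm (fun k => hge _) hlim

/-! ### Powers of Schur stable matrices and of their congruence operators. -/

section L2
open scoped Matrix.Norms.L2Operator

variable {n : ℕ}

/-- The powers of a Schur stable matrix are summable in norm. -/
theorem SchurStable.summable_norm_pow {A : Matrix (Fin n) (Fin n) ℝ} (hA : SchurStable A) :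
    Summable fun k => ‖A ^ k‖ := by
  set Z : Matrix (Fin n) (Fin n) ℂ := A.map (algebraMap ℝ ℂ) with hZ
  have hr : spectralRadius ℂ Z < 1 := by
    -- In dimension 0 the spectrum is empty, so the bound on eigenvalues needs a separate case.
    rcases isEmpty_or_nonempty (Fin n) with h | h
    · have : Subsingleton (Matrix (Fin n) (Fin n) ℂ) := inferInstance
      simp [spectralRadius, spectrum.of_subsingleton]
    · have := spectrum.spectralRadius_lt_of_forall_lt Z (r := 1) (fun z hz => hA z hz)
      simpa using this
  obtain ⟨r, hr1, hr2⟩ := ENNReal.lt_iff_exists_nnreal_btwn.1 hr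
  have hr3 : r < 1 := by exact_mod_cast hr2
  -- Gelfand's formula, with `r` strictly between the spectral radius and 1.
  have hev : ∀ᶠ k : ℕ in atTop, ‖Z ^ k‖ ≤ (r : ℝ) ^ k := by
    have := (spectrum.pow_nnnorm_pow_one_div_tendsto_nhds_spectralRadius Z).eventually
      (gt_mem_nhds hr1)
    filter_upwards [this, eventually_gt_atTop 0] with k hk hk0
    have hk' : (0 : ℝ) < k := by exact_mod_cast hk0
    have h1 := ENNReal.rpow_le_rpow hk.le hk'.le
    rw [← ENNReal.rpow_mul, one_div_mul_cancel hk'.ne', ENNReal.rpow_one,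
      ENNReal.rpow_natCast] at h1
    exact_mod_cast h1
  -- The entrywise real part carries the bound back from `Z ^ k` to `A ^ k`, at the cost of a
  -- constant independent of `k`.
  set R := LinearMap.toContinuousLinearMap
    (Complex.reLm.mapMatrix : Matrix (Fin n) (Fin n) ℂ →ₗ[ℝ] Matrix (Fin n) (Fin n) ℝ) with hR
  have hRZ : ∀ k, R (Z ^ k) = A ^ k := by
    intro k
    have : Z ^ k = (A ^ k).map (algebraMap ℝ ℂ) := by
      rw [hZ]
      exact (map_pow (algebraMap ℝ ℂ).mapMatrix A k).symm
    rw [this]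
    ext i j
    simp [hR]
  refine Summable.of_norm_bounded_eventually_nat (g := fun k => ‖R‖ * (r : ℝ) ^ k)
    ((summable_geometric_of_lt_one r.2 (by exact_mod_cast hr3)).mul_left _) ?_
  filter_upwards [hev] with k hk
  rw [norm_norm, ← hRZ]
  exact (R.le_opNorm _).trans (by gcongr)

/-- The congruence `M ↦ F M Fᵀ` as a continuous linear map. -/
noncomputable def congrCLM (F : Matrix (Fin n) (Fin n) ℝ) :
    Matrix (Fin n) (Fin n) ℝ →L[ℝ] Matrix (Fin n) (Fin n) ℝ :=
  ContinuousLinearMap.mulLeftRight ℝ _ F Fᵀ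

theorem congrCLM_apply (F M : Matrix (Fin n) (Fin n) ℝ) : congrCLM F M = F * M * Fᵀ := by
  simp [congrCLM]

theorem continuous_congrCLM :
    Continuous (congrCLM : Matrix (Fin n) (Fin n) ℝ → _) := by
  unfold congrCLM
  have h : Continuous fun F : Matrix (Fin n) (Fin n) ℝ => Fᵀ := continuous_id.matrix_transpose
  fun_prop

theorem congrCLM_pow_apply (F M : Matrix (Fin n) (Fin n) ℝ) (k : ℕ) :
    (congrCLM F ^ k) M = F ^ k * M * (F ^ k)ᵀ := by
  induction k with
  | zero => simp
  | succ k ih =>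
    rw [pow_succ', mul_apply_eq_comp, ih, congrCLM_apply, pow_succ']
    simp only [Matrix.transpose_mul, Matrix.mul_assoc]

theorem norm_transpose_eq (F : Matrix (Fin n) (Fin n) ℝ) : ‖Fᵀ‖ = ‖F‖ := by
  rw [← Matrix.conjTranspose_eq_transpose_of_trivial, Matrix.l2_opNorm_conjTranspose]

theorem SchurStable.summable_norm_congrCLM_pow {F : Matrix (Fin n) (Fin n) ℝ}
    (hF : SchurStable F) : Summable fun k => ‖congrCLM F ^ k‖ := by
  have h := hF.summable_norm_pow
  -- The congruence contributes two factors `‖F ^ k‖`; bounding one by 1 leaves a summable majorant.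
  have h0 : ∀ᶠ k in atTop, ‖F ^ k‖ ≤ 1 :=
    (h.tendsto_atTop_zero.eventually (gt_mem_nhds one_pos)).mono fun _ hk => hk.le
  refine Summable.of_norm_bounded_eventually_nat h ?_
  filter_upwards [h0] with k hk
  refine (norm_norm (congrCLM F ^ k)).trans_le ?_
  refine ContinuousLinearMap.opNorm_le_bound _ (norm_nonneg _) fun M => ?_
  rw [congrCLM_pow_apply]
  calc ‖F ^ k * M * (F ^ k)ᵀ‖ ≤ ‖F ^ k‖ * ‖M‖ * ‖(F ^ k)ᵀ‖ :=
        (norm_mul_le _ _).trans (by gcongr; exact norm_mul_le _ _)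
    _ ≤ ‖F ^ k‖ * ‖M‖ * 1 := by rw [norm_transpose_eq]; gcongr
    _ = _ := mul_one _

end L2

/-! ### Discrete Lyapunov equations. -/

section Lyapunov
variable {n : ℕ}

/-- A perturbed discrete Lyapunov recursion converges to the fixed point of the limit recursion. -/
theorem tendsto_lyapunov_recursion {F M S : Matrix (Fin n) (Fin n) ℝ} (hF : SchurStable F)
    (hS : S = F * S * Fᵀ + M) {Fk Mk X : ℕ → Matrix (Fin n) (Fin n) ℝ}
    (hFk : Tendsto Fk atTop (𝓝 F)) (hMk : Tendsto Mk atTop (𝓝 M))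
    (hX : ∀ k, X (k + 1) = Fk k * X k * (Fk k)ᵀ + Mk k) : Tendsto X atTop (𝓝 S) := by
  open scoped Matrix.Norms.L2Operator in
  have key : Tendsto (fun k => X k - S) atTop (𝓝 0) := by
    refine tendsto_zero_of_linear_recursion hF.summable_norm_congrCLM_pow
      (S := fun k => congrCLM (Fk k)) (u := fun k => Fk k * S * (Fk k)ᵀ + Mk k - S)
      ((continuous_congrCLM.tendsto F).comp hFk) ?_ ?_
    · have : Tendsto (fun k => Fk k * S * (Fk k)ᵀ + Mk k - S) atTop
          (𝓝 (F * S * Fᵀ + M - S)) :=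
        (((hFk.mul_const S).mul
          ((continuous_id.matrix_transpose.tendsto F).comp hFk)).add hMk).sub_const S
      rwa [← hS, sub_self] at this
    · intro k
      rw [congrCLM_apply, hX]
      noncomm_ring
  simpa using key.add_const S

theorem posSemidef_of_tendsto {ι : Type*} {l : Filter ι} [l.NeBot]
    {X : ι → Matrix (Fin n) (Fin n) ℝ} {S : Matrix (Fin n) (Fin n) ℝ} (h : Tendsto X l (𝓝 S))
    (hX : ∀ᶠ i in l, (X i).PosSemidef) : S.PosSemidef := by
  refine Matrix.PosSemidef.of_dotProduct_mulVec_nonneg ?_ fun v => ?_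
  · refine tendsto_nhds_unique (((continuous_id.matrix_conjTranspose).tendsto S).comp h) ?_
    exact h.congr' (hX.mono fun i hi => hi.isHermitian.eq.symm)
  · have hc : Continuous fun M : Matrix (Fin n) (Fin n) ℝ => star v ⬝ᵥ (M *ᵥ v) :=
      continuous_const.dotProduct (continuous_id.matrix_mulVec continuous_const)
    exact ge_of_tendsto ((hc.tendsto S).comp h) (hX.mono fun i hi => hi.dotProduct_mulVec_nonneg v)

/-- A stable discrete Lyapunov equation with positive semidefinite input has a positive
semidefinite solution. -/
theorem exists_lyapunov {F M : Matrix (Fin n) (Fin n) ℝ} (hF : SchurStable F)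
    (hM : M.PosSemidef) : ∃ S : Matrix (Fin n) (Fin n) ℝ, S.PosSemidef ∧ S = F * S * Fᵀ + M := by
  -- The solution is the series of the `F ^ k * M * (F ^ k)ᵀ`; congruence by `F` shifts it by one
  -- term.
  open scoped Matrix.Norms.L2Operator in
  have hs : Summable fun k => (congrCLM F ^ k) M :=
    Summable.of_norm_bounded (hF.summable_norm_congrCLM_pow.mul_right ‖M‖)
      fun k => (congrCLM F ^ k).le_opNorm M
  refine ⟨∑' k, (congrCLM F ^ k) M, ?_, ?_⟩
  · have hpos : ∀ s : Finset ℕ, (∑ k ∈ s, (congrCLM F ^ k) M).PosSemidef := fun s =>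
      Matrix.posSemidef_sum s fun k _ => by
        rw [congrCLM_pow_apply, ← Matrix.conjTranspose_eq_transpose_of_trivial]
        exact hM.mul_mul_conjTranspose_same _
    exact posSemidef_of_tendsto hs.hasSum (Eventually.of_forall hpos)
  · conv_lhs => rw [hs.tsum_eq_zero_add]
    rw [← congrCLM_apply, (congrCLM F).map_tsum hs, add_comm]
    simp [pow_succ']

/-- A second solution is a constant trajectory of a recursion that converges to the first. -/
theorem lyapunov_unique {F M S S' : Matrix (Fin n) (Fin n) ℝ} (hF : SchurStable F)
    (hS : S = F * S * Fᵀ + M) (hS' : S' = F * S' * Fᵀ + M) : S' = S :=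
  tendsto_nhds_unique tendsto_const_nhds
    (tendsto_lyapunov_recursion hF hS tendsto_const_nhds tendsto_const_nhds
      (X := fun _ => S') fun _ => hS')

end Lyapunov

/-! ### Order properties and convergence of the Riccati recursion. -/

section Riccati
open Matrix
open scoped MatrixOrder

variable {n : ℕ} {A : Matrix (Fin n) (Fin n) ℝ} {C : Fin n → ℝ} {Q : Matrix (Fin n) (Fin n) ℝ}
  {γ : ℝ} {P P' : Matrix (Fin n) (Fin n) ℝ}

/-- The prediction error covariance after one step of the filter with an arbitrary gain `K`. -/
def gainStep (A : Matrix (Fin n) (Fin n) ℝ) (C : Fin n → ℝ) (Q : Matrix (Fin n) (Fin n) ℝ)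
    (γ : ℝ) (K : Fin n → ℝ) (P : Matrix (Fin n) (Fin n) ℝ) : Matrix (Fin n) (Fin n) ℝ :=
  (A - vecMulVec K C) * P * (A - vecMulVec K C)ᵀ + γ • vecMulVec K K + Q

/-- One step of the Riccati recursion. -/
noncomputable def riccatiStep (A : Matrix (Fin n) (Fin n) ℝ) (C : Fin n → ℝ)
    (Q : Matrix (Fin n) (Fin n) ℝ) (γ : ℝ) (P : Matrix (Fin n) (Fin n) ℝ) :
    Matrix (Fin n) (Fin n) ℝ :=
  gainStep A C Q γ (gain A C γ P) P

theorem predCov_succ (k : ℕ) :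
    predCov A C Q γ P (k + 1) = riccatiStep A C Q γ (predCov A C Q γ P k) := rfl

theorem outputVar_nonneg (hP : 0 ≤ P) : 0 ≤ outputVar C P := by
  simpa [outputVar] using (nonneg_iff_posSemidef.1 hP).dotProduct_mulVec_nonneg C

theorem outputVar_add_pos (hγ : 0 < γ) (hP : 0 ≤ P) : 0 < outputVar C P + γ := by
  linarith [outputVar_nonneg (C := C) hP]

theorem smul_gain (hd : outputVar C P + γ ≠ 0) :
    (outputVar C P + γ) • gain A C γ P = (A * P) *ᵥ C := by
  rw [gain, smul_smul, mul_inv_cancel₀ hd, one_smul]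

/-- This is the stationarity condition of `gainStep` in the gain. It removes the linear terms when
completing the square, and later makes prediction errors orthogonal to past outputs. -/
theorem closedLoop_mul_mulVec (hd : outputVar C P + γ ≠ 0) :
    (closedLoop A C γ P * P) *ᵥ C = γ • gain A C γ P := by
  have h : (closedLoop A C γ P * P) *ᵥ C
      = (A * P) *ᵥ C - outputVar C P • gain A C γ P := by
    rw [closedLoop, Matrix.sub_mul, Matrix.sub_mulVec, vecMulVec_mul, vecMulVec_mulVec,
      ← dotProduct_mulVec, ← outputVar]
    simp
  rw [h, ← smul_gain hd, add_smul, add_sub_cancel_left]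

theorem gainStep_eq_add (K₀ K : Fin n → ℝ) (hs : Pᵀ = P) :
    (A - vecMulVec K C) * P * (A - vecMulVec K C)ᵀ =
      (A - vecMulVec K₀ C) * P * (A - vecMulVec K₀ C)ᵀ
        - vecMulVec (((A - vecMulVec K₀ C) * P) *ᵥ C) (K - K₀)
        - vecMulVec (K - K₀) (((A - vecMulVec K₀ C) * P) *ᵥ C)
        + outputVar C P • vecMulVec (K - K₀) (K - K₀) := by
  obtain ⟨F, hF⟩ : ∃ F, F = A - vecMulVec K₀ C := ⟨_, rfl⟩
  obtain ⟨D, hD⟩ : ∃ D, D = K - K₀ := ⟨_, rfl⟩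
  have h1 : A - vecMulVec K C = F - vecMulVec D C := by
    rw [hF, hD, sub_vecMulVec]; abel
  have h2 : (F * P) *ᵥ C = C ᵥ* (P * Fᵀ) := by
    rw [← vecMul_transpose, transpose_mul, hs]
  rw [h1, ← hF, ← hD, transpose_sub, transpose_vecMulVec, Matrix.sub_mul, Matrix.sub_mul,
    Matrix.mul_sub, Matrix.mul_sub, mul_vecMulVec, Matrix.mul_assoc (vecMulVec D C) P Fᵀ,
    vecMulVec_mul, ← h2, vecMulVec_mul, vecMulVec_mul_vecMulVec, ← dotProduct_mulVec, ← outputVar]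
  simp only [vecMulVec_smul]
  abel

/-- Completing the square in `K`: the Kalman gain minimizes `gainStep` in the Loewner order. -/
theorem gainStep_eq (hd : outputVar C P + γ ≠ 0) (hs : Pᵀ = P) (K : Fin n → ℝ) :
    gainStep A C Q γ K P = riccatiStep A C Q γ P
      + (outputVar C P + γ) • vecMulVec (K - gain A C γ P) (K - gain A C γ P) := by
  have h := closedLoop_mul_mulVec (A := A) hd
  rw [closedLoop] at h
  rw [riccatiStep, gainStep, gainStep, gainStep_eq_add (gain A C γ P) K hs, h]
  ext i j
  simp [vecMulVec_apply]
  ring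

theorem riccatiStep_eq (hd : outputVar C P + γ ≠ 0) :
    riccatiStep A C Q γ P = closedLoop A C γ P * P * Aᵀ + Q := by
  have h := closedLoop_mul_mulVec (A := A) hd
  rw [riccatiStep, gainStep, ← closedLoop]
  have h2 : (closedLoop A C γ P)ᵀ = Aᵀ - vecMulVec C (gain A C γ P) := by
    rw [closedLoop, transpose_sub, transpose_vecMulVec]
  rw [h2, Matrix.mul_sub, mul_vecMulVec, h, smul_vecMulVec]
  abel

theorem isRiccatiSolution_iff (hγ : 0 < γ) :
    IsRiccatiSolution A C Q γ P ↔ 0 ≤ P ∧ riccatiStep A C Q γ P = P := by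
  rw [IsRiccatiSolution, nonneg_iff_posSemidef]
  refine and_congr_right fun hP => ?_
  rw [riccatiStep_eq (outputVar_add_pos hγ (nonneg_iff_posSemidef.2 hP)).ne', eq_comm]
  have : closedLoop A C γ P * P * Aᵀ = A * P * Aᵀ
      - (outputVar C P + γ)⁻¹ • vecMulVec ((A * P) *ᵥ C) (C ᵥ* (P * Aᵀ)) := by
    rw [closedLoop, Matrix.sub_mul, Matrix.sub_mul, Matrix.mul_assoc (vecMulVec _ _),
      vecMulVec_mul, gain, smul_vecMulVec]
  rw [this, sub_add_eq_add_sub]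

theorem transpose_eq_of_nonneg (hP : 0 ≤ P) : Pᵀ = P := by
  simpa using (nonneg_iff_posSemidef.1 hP).isHermitian.eq

theorem vecMulVec_self_nonneg (K : Fin n → ℝ) : 0 ≤ vecMulVec K K := by
  simpa using nonneg_iff_posSemidef.2 (posSemidef_vecMulVec_self_star K)

theorem smul_nonneg_of_nonneg {c : ℝ} (hc : 0 ≤ c) (hP : 0 ≤ P) : 0 ≤ c • P :=
  nonneg_iff_posSemidef.2 ((nonneg_iff_posSemidef.1 hP).smul hc)

theorem mul_mul_transpose_mono (F : Matrix (Fin n) (Fin n) ℝ) (h : P ≤ P') :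
    F * P * Fᵀ ≤ F * P' * Fᵀ := by
  rw [le_iff] at h ⊢
  have := h.mul_mul_conjTranspose_same F
  rwa [conjTranspose_eq_transpose_of_trivial, Matrix.mul_sub, Matrix.sub_mul] at this

theorem gainStep_mono (K : Fin n → ℝ) (h : P ≤ P') :
    gainStep A C Q γ K P ≤ gainStep A C Q γ K P' := by
  unfold gainStep
  gcongr
  exact mul_mul_transpose_mono _ h

theorem riccatiStep_le_gainStep (hγ : 0 < γ) (hP : 0 ≤ P) (K : Fin n → ℝ) :
    riccatiStep A C Q γ P ≤ gainStep A C Q γ K P := by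
  rw [gainStep_eq (outputVar_add_pos hγ hP).ne' (transpose_eq_of_nonneg hP) K]
  exact le_add_of_nonneg_right
    (smul_nonneg_of_nonneg (outputVar_add_pos hγ hP).le (vecMulVec_self_nonneg _))

/-- The optimal gain for `P'` is merely admissible for `P`, and with that gain fixed the step is
monotone. -/
theorem riccatiStep_mono (hγ : 0 < γ) (hP : 0 ≤ P) (h : P ≤ P') :
    riccatiStep A C Q γ P ≤ riccatiStep A C Q γ P' :=
  (riccatiStep_le_gainStep hγ hP _).trans (gainStep_mono _ h)

theorem gainStep_nonneg (hγ : 0 < γ) (hQ : 0 ≤ Q) (hP : 0 ≤ P) (K : Fin n → ℝ) :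
    0 ≤ gainStep A C Q γ K P := by
  refine add_nonneg (add_nonneg ?_ (smul_nonneg_of_nonneg hγ.le (vecMulVec_self_nonneg _))) hQ
  simpa using mul_mul_transpose_mono (A - vecMulVec K C) hP

theorem predCov_nonneg (hγ : 0 < γ) (hQ : 0 ≤ Q) (hP : 0 ≤ P) (k : ℕ) :
    0 ≤ predCov A C Q γ P k := by
  induction k with
  | zero => exact hP
  | succ k ih => exact gainStep_nonneg hγ hQ ih _

theorem predCov_mono_init (hγ : 0 < γ) (hQ : 0 ≤ Q) (hP : 0 ≤ P) (h : P ≤ P') (k : ℕ) :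
    predCov A C Q γ P k ≤ predCov A C Q γ P' k := by
  induction k with
  | zero => exact h
  | succ k ih => exact riccatiStep_mono hγ (predCov_nonneg hγ hQ hP k) ih

theorem monotone_predCov_zero (hγ : 0 < γ) (hQ : 0 ≤ Q) : Monotone (predCov A C Q γ 0) := by
  refine monotone_nat_of_le_succ fun k => ?_
  induction k with
  | zero => exact gainStep_nonneg hγ hQ le_rfl _
  | succ k ih => exact riccatiStep_mono hγ (predCov_nonneg hγ hQ le_rfl k) ih

theorem continuous_outputVar : Continuous (outputVar C) :=
  continuous_const.dotProduct (continuous_id.matrix_mulVec continuous_const)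

theorem continuousAt_gain (hd : outputVar C P + γ ≠ 0) : ContinuousAt (gain A C γ) P := by
  refine ContinuousAt.smul (f := fun P => (outputVar C P + γ)⁻¹) (g := fun P => (A * P) *ᵥ C) ?_ ?_
  · exact (continuous_outputVar.continuousAt.add continuousAt_const).inv₀ hd
  · exact ((continuous_const.mul continuous_id).matrix_mulVec continuous_const).continuousAt

theorem continuous_vecMulVec : Continuous fun p : (Fin n → ℝ) × (Fin n → ℝ) =>
    vecMulVec p.1 p.2 :=
  continuous_fst.matrix_vecMulVec continuous_snd

theorem continuousAt_closedLoop (hd : outputVar C P + γ ≠ 0) :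
    ContinuousAt (closedLoop A C γ) P := by
  unfold closedLoop
  refine continuousAt_const.sub ?_
  exact (continuous_vecMulVec.comp (continuous_id.prodMk continuous_const)).continuousAt.comp
    (continuousAt_gain hd)

theorem continuousAt_riccatiStep (hd : outputVar C P + γ ≠ 0) :
    ContinuousAt (riccatiStep A C Q γ) P := by
  have h1 := continuousAt_closedLoop (A := A) hd
  have h2 := continuousAt_gain (A := A) hd
  have h3 : ContinuousAt (fun P => (closedLoop A C γ P)ᵀ) P :=
    continuous_id.matrix_transpose.continuousAt.comp h1
  have h4 : ContinuousAt (fun P => vecMulVec (gain A C γ P) (gain A C γ P)) P :=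
    (continuous_vecMulVec.comp (continuous_id.prodMk continuous_id)).continuousAt.comp h2
  exact (((h1.mul continuousAt_id).mul h3).add (h4.const_smul γ)).add continuousAt_const

/-- Polarization: the entries of a symmetric matrix from its quadratic form. -/
theorem apply_eq_polarization (hs : Pᵀ = P) (i j : Fin n) :
    P i j = (outputVar (Pi.single i 1 + Pi.single j 1) P - outputVar (Pi.single i 1) P
      - outputVar (Pi.single j 1) P) / 2 := by
  have : P j i = P i j := by conv_lhs => rw [← hs, transpose_apply]
  simp [outputVar, mulVec_add, add_dotProduct, dotProduct_add, this]
  ring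

theorem outputVar_mono (v : Fin n → ℝ) (h : P ≤ P') : outputVar v P ≤ outputVar v P' := by
  have := (le_iff.1 h).dotProduct_mulVec_nonneg v
  simp only [outputVar, sub_mulVec, dotProduct_sub, star_trivial] at *
  linarith

/-- Polarization reduces matrix convergence to quadratic forms, so scalar monotone and squeeze
arguments apply to the Loewner order. -/
theorem tendsto_of_outputVar {ι : Type*} {l : Filter ι} {X : ι → Matrix (Fin n) (Fin n) ℝ}
    (hX : ∀ i, (X i)ᵀ = X i) {q : (Fin n → ℝ) → ℝ}
    (h : ∀ v, Tendsto (fun i => outputVar v (X i)) l (𝓝 (q v))) :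
    Tendsto X l (𝓝 (of fun i j => (q (Pi.single i 1 + Pi.single j 1) - q (Pi.single i 1)
      - q (Pi.single j 1)) / 2)) := by
  refine tendsto_pi_nhds.2 fun i => tendsto_pi_nhds.2 fun j => ?_
  simp_rw [apply_eq_polarization (hX _) i j]
  exact (((h _).sub (h _)).sub (h _)).div_const 2

/-- A monotone sequence of positive semidefinite matrices that is bounded above converges. -/
theorem exists_tendsto_of_monotone {X : ℕ → Matrix (Fin n) (Fin n) ℝ} (hm : Monotone X)
    (h0 : ∀ k, 0 ≤ X k) (hb : ∀ k, X k ≤ P) : ∃ L, Tendsto X atTop (𝓝 L) := by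
  refine ⟨_, tendsto_of_outputVar (fun k => transpose_eq_of_nonneg (h0 k))
    (q := fun v => ⨆ k, outputVar v (X k)) fun v => ?_⟩
  refine tendsto_atTop_ciSup (fun _ _ h => outputVar_mono v (hm h)) ⟨outputVar v P, ?_⟩
  rintro _ ⟨k, rfl⟩
  exact outputVar_mono v (hb k)

theorem tendsto_of_le_of_le {X Y Z : ℕ → Matrix (Fin n) (Fin n) ℝ} (hP : Pᵀ = P)
    (hX : Tendsto X atTop (𝓝 P)) (hZ : Tendsto Z atTop (𝓝 P)) (hY : ∀ k, 0 ≤ Y k)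
    (hXY : ∀ k, X k ≤ Y k) (hYZ : ∀ k, Y k ≤ Z k) : Tendsto Y atTop (𝓝 P) := by
  have h := tendsto_of_outputVar (l := atTop) (fun k => transpose_eq_of_nonneg (hY k))
    (q := fun v => outputVar v P) fun v =>
      tendsto_of_tendsto_of_tendsto_of_le_of_le
        ((continuous_outputVar.tendsto P).comp hX) ((continuous_outputVar.tendsto P).comp hZ)
        (fun k => outputVar_mono v (hXY k)) (fun k => outputVar_mono v (hYZ k))
  convert h using 2
  ext i j
  exact apply_eq_polarization hP i j

/-- A stabilizing output injection has a stationary error covariance `S`. Optimal gains do no worse,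
so the increasing trajectory from 0 stays below `S`. -/
theorem exists_riccati_tendsto (hγ : 0 < γ) (hQ : 0 ≤ Q) (hdet : Detectable A C) :
    ∃ L, 0 ≤ L ∧ riccatiStep A C Q γ L = L ∧ Tendsto (predCov A C Q γ 0) atTop (𝓝 L) := by
  obtain ⟨K, hK⟩ := hdet
  obtain ⟨S, hS, hS'⟩ := exists_lyapunov (M := γ • vecMulVec K K + Q) hK
    (nonneg_iff_posSemidef.1
      (add_nonneg (smul_nonneg_of_nonneg hγ.le (vecMulVec_self_nonneg _)) hQ))
  have hS'' : gainStep A C Q γ K S = S := by rw [gainStep, add_assoc, ← hS']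
  have h0 := predCov_nonneg (A := A) (C := C) hγ hQ (le_refl 0)
  have hb : ∀ k, predCov A C Q γ 0 k ≤ S := by
    intro k
    induction k with
    | zero => exact nonneg_iff_posSemidef.2 hS
    | succ k ih =>
      calc _ ≤ _ := riccatiStep_le_gainStep hγ (h0 k) K
        _ ≤ _ := gainStep_mono K ih
        _ = S := hS''
  obtain ⟨L, hL⟩ := exists_tendsto_of_monotone (monotone_predCov_zero hγ hQ) h0 hb
  have hL0 : 0 ≤ L := nonneg_iff_posSemidef.2
    (posSemidef_of_tendsto hL (Eventually.of_forall fun k => nonneg_iff_posSemidef.1 (h0 k)))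
  refine ⟨L, hL0, ?_, hL⟩
  refine tendsto_nhds_unique
    ((continuousAt_riccatiStep (outputVar_add_pos hγ hL0).ne').tendsto.comp hL) ?_
  exact hL.comp (tendsto_add_atTop_nat 1)

/-- If the closed loop at a fixed point of the Riccati recursion is stable, the fixed point
attracts every trajectory that dominates one already converging to it. -/
theorem tendsto_predCov (hγ : 0 < γ) (hQ : 0 ≤ Q) {L : Matrix (Fin n) (Fin n) ℝ} (hL0 : 0 ≤ L)
    (hfix : riccatiStep A C Q γ L = L) (hL : Tendsto (predCov A C Q γ 0) atTop (𝓝 L))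
    (hst : SchurStable (closedLoop A C γ L)) (hP : 0 ≤ P) :
    Tendsto (predCov A C Q γ P) atTop (𝓝 L) := by
  set K := gain A C γ L with hK
  have hfix' : L = closedLoop A C γ L * L * (closedLoop A C γ L)ᵀ + (γ • vecMulVec K K + Q) := by
    conv_lhs => rw [← hfix]
    rw [riccatiStep, gainStep, add_assoc, closedLoop]
  -- With the gain frozen at `K` the recursion is a stable Lyapunov recursion with fixed point `L`;
  -- it dominates the Riccati trajectory from the same start.
  have hZ : Tendsto (fun k => (gainStep A C Q γ K)^[k] P) atTop (𝓝 L) := by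
    refine tendsto_lyapunov_recursion hst hfix' tendsto_const_nhds tendsto_const_nhds fun k => ?_
    rw [Function.iterate_succ_apply', gainStep, add_assoc, closedLoop]
  refine tendsto_of_le_of_le (transpose_eq_of_nonneg hL0) hL hZ (predCov_nonneg hγ hQ hP)
    (predCov_mono_init hγ hQ le_rfl hP) fun k => ?_
  induction k with
  | zero => exact le_rfl
  | succ k ih =>
    rw [Function.iterate_succ_apply']
    exact (riccatiStep_le_gainStep hγ (predCov_nonneg hγ hQ hP k) K).trans (gainStep_mono K ih)

end Riccati

/-! ### Stability of the closed loop, by left eigenvectors. -/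

section Stability
open Matrix

variable {n : ℕ}

theorem mem_spectrum_iff_exists_vecMul {M : Matrix (Fin n) (Fin n) ℂ} {z : ℂ} :
    z ∈ spectrum ℂ M ↔ ∃ v ≠ 0, v ᵥ* M = z • v := by
  rw [spectrum.mem_iff, Matrix.isUnit_iff_isUnit_det, isUnit_iff_ne_zero, not_not,
    ← exists_vecMul_eq_zero_iff]
  refine exists_congr fun v => and_congr_right fun _ => ?_
  rw [vecMul_sub, sub_eq_zero, algebraMap_eq_diagonal]
  simp [eq_comm, vecMul_diagonal, funext_iff, mul_comm]

theorem vecMul_map_eq_smul_iff {M : Matrix (Fin n) (Fin n) ℝ} {z : ℂ} {v : Fin n → ℂ} :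
    v ᵥ* M.map (algebraMap ℝ ℂ) = z • v ↔
      (fun i => (v i).re) ᵥ* M = z.re • (fun i => (v i).re) - z.im • (fun i => (v i).im) ∧
      (fun i => (v i).im) ᵥ* M = z.im • (fun i => (v i).re) + z.re • (fun i => (v i).im) := by
  simp only [funext_iff, ← forall_and]
  refine forall_congr' fun j => ?_
  rw [Complex.ext_iff]
  simp [vecMul, dotProduct, add_comm]

theorem outputVar_mul_mul_transpose (a : Fin n → ℝ) (F P : Matrix (Fin n) (Fin n) ℝ) :
    outputVar a (F * P * Fᵀ) = outputVar (a ᵥ* F) P := by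
  rw [outputVar, outputVar, ← mulVec_mulVec, ← mulVec_mulVec, dotProduct_mulVec, mulVec_transpose]

theorem outputVar_vecMulVec_self (a K : Fin n → ℝ) :
    outputVar a (vecMulVec K K) = (a ⬝ᵥ K) ^ 2 := by
  simp [outputVar, vecMulVec_mulVec, dotProduct_comm K a, sq]

theorem outputVar_one (a : Fin n → ℝ) : outputVar a 1 = a ⬝ᵥ a := by
  simp [outputVar]

theorem outputVar_add (a : Fin n → ℝ) (M N : Matrix (Fin n) (Fin n) ℝ) :
    outputVar a (M + N) = outputVar a M + outputVar a N := by
  simp [outputVar, add_mulVec]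

theorem outputVar_smul (a : Fin n → ℝ) (c : ℝ) (M : Matrix (Fin n) (Fin n) ℝ) :
    outputVar a (c • M) = c * outputVar a M := by
  simp [outputVar, smul_mulVec]

/-- Real form of the scaling of v P v* by |z|² when v is multiplied by z = x + iy, where v = a + ib.
-/
theorem outputVar_rotation {P : Matrix (Fin n) (Fin n) ℝ} (hs : Pᵀ = P) (x y : ℝ)
    (a b : Fin n → ℝ) :
    outputVar (x • a - y • b) P + outputVar (y • a + x • b) P =
      (x ^ 2 + y ^ 2) * (outputVar a P + outputVar b P) := by
  have h : b ⬝ᵥ P *ᵥ a = a ⬝ᵥ P *ᵥ b := by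
    rw [dotProduct_comm, ← vecMul_transpose, hs, ← dotProduct_mulVec]
  simp only [outputVar, mulVec_add, mulVec_sub, mulVec_smul, add_dotProduct, sub_dotProduct,
    dotProduct_add, dotProduct_sub, smul_dotProduct, dotProduct_smul, smul_eq_mul, h]
  ring

/-- The closed loop at a positive semidefinite solution of the Riccati equation is stable. -/
theorem schurStable_closedLoop {A B Q P : Matrix (Fin n) (Fin n) ℝ} {C : Fin n → ℝ} {γ : ℝ}
    (hγ : 0 < γ) (hB : B * Bᵀ = Q) (hst : Stabilizable A B) (hP : P.PosSemidef)
    (hfix : riccatiStep A C Q γ P = P) : SchurStable (closedLoop A C γ P) := by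
  obtain ⟨F, hF⟩ := hst
  set K := gain A C γ P with hK
  intro z hz
  by_contra! hz1
  obtain ⟨v, hv0, hv⟩ := mem_spectrum_iff_exists_vecMul.1 hz
  obtain ⟨ha, hb⟩ := vecMul_map_eq_smul_iff.1 hv
  set a : Fin n → ℝ := fun i => (v i).re
  set b : Fin n → ℝ := fun i => (v i).im
  have hs : Pᵀ = P := by simpa using hP.isHermitian.eq
  have hq : ∀ u : Fin n → ℝ, outputVar u P = outputVar (u ᵥ* closedLoop A C γ P) P
      + γ * (u ⬝ᵥ K) ^ 2 + (u ᵥ* B) ⬝ᵥ (u ᵥ* B) := by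
    intro u
    conv_lhs => rw [← hfix]
    rw [riccatiStep, gainStep, ← closedLoop, outputVar_add, outputVar_add, outputVar_smul,
      outputVar_mul_mul_transpose, outputVar_vecMulVec_self, show Q = B * 1 * Bᵀ by rw [Matrix.mul_one, hB],
      outputVar_mul_mul_transpose, outputVar_one]
  have hPn : ∀ u, 0 ≤ outputVar u P := fun u => by
    simpa [outputVar] using hP.dotProduct_mulVec_nonneg u
  have hBn : ∀ u : Fin n → ℝ, 0 ≤ (u ᵥ* B) ⬝ᵥ (u ᵥ* B) := fun u => by
    simpa using dotProduct_star_self_nonneg (u ᵥ* B)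
  have hrot := outputVar_rotation hs z.re z.im a b
  have hz2 : 1 ≤ z.re ^ 2 + z.im ^ 2 := by
    have h1 : (1 : ℝ) ≤ ‖z‖ ^ 2 := one_le_pow₀ hz1
    rw [Complex.sq_norm, Complex.normSq_apply] at h1
    nlinarith
  have hqa := hq a
  have hqb := hq b
  rw [ha] at hqa
  rw [hb] at hqb
  -- Add the identities `hq` for `a` and `b`: the terms in `P` on the right are |z|² ≥ 1 times those
  -- on the left, so every nonnegative term in `K` and `B` must vanish.
  have hle := mul_le_mul_of_nonneg_right hz2 (add_nonneg (hPn a) (hPn b))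
  have ha2 : 0 ≤ γ * (a ⬝ᵥ K) ^ 2 := by positivity
  have hb2 : 0 ≤ γ * (b ⬝ᵥ K) ^ 2 := by positivity
  have hKzero : ∀ u : Fin n → ℝ, γ * (u ⬝ᵥ K) ^ 2 ≤ 0 → u ⬝ᵥ K = 0 := fun u hu => by
    have h1 : γ * (u ⬝ᵥ K) ^ 2 = 0 := le_antisymm hu (by positivity)
    simpa [hγ.ne'] using h1
  have hBzero : ∀ u : Fin n → ℝ, (u ᵥ* B) ⬝ᵥ (u ᵥ* B) ≤ 0 → u ᵥ* B = 0 := fun u hu =>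
    dotProduct_self_eq_zero.1 (le_antisymm hu (hBn u))
  -- On vectors killing both `K` and `B` neither feedback acts, so `v` is also a left eigenvector of
  -- `A - B * F`, for the same unstable `z`.
  have hclosed : ∀ u : Fin n → ℝ, u ⬝ᵥ K = 0 → u ᵥ* B = 0 →
      u ᵥ* (A - B * F) = u ᵥ* closedLoop A C γ P := fun u h1 h2 => by
    rw [closedLoop, vecMul_sub, vecMul_sub, ← vecMul_vecMul, h2, vecMul_vecMulVec, ← hK, h1]
    simp
  have hBa := hBn a
  have hBb := hBn b
  have hFz : z ∈ spectrum ℂ ((A - B * F).map (algebraMap ℝ ℂ)) := by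
    refine mem_spectrum_iff_exists_vecMul.2 ⟨v, hv0, vecMul_map_eq_smul_iff.2 ⟨?_, ?_⟩⟩
    · exact (hclosed a (hKzero a (by linarith)) (hBzero a (by linarith))).trans ha
    · exact (hclosed b (hKzero b (by linarith)) (hBzero b (by linarith))).trans hb
  exact absurd (hF z hFz) (not_lt.2 hz1)

end Stability

/-! ### Innovations and the triangular factorization of the output covariance. -/

section Innovations
open Matrix

variable {n : ℕ} {A : Matrix (Fin n) (Fin n) ℝ} {C : Fin n → ℝ} {Q : Matrix (Fin n) (Fin n) ℝ}
  {γ : ℝ} {P₀ : Matrix (Fin n) (Fin n) ℝ} {S : ℕ → ℕ → Matrix (Fin n) (Fin n) ℝ}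

/-- The coefficient of the output `y_j` in the one-step-ahead prediction of `x_k`. -/
noncomputable def predCoeff (A : Matrix (Fin n) (Fin n) ℝ) (C : Fin n → ℝ)
    (Q : Matrix (Fin n) (Fin n) ℝ) (γ : ℝ) (P₀ : Matrix (Fin n) (Fin n) ℝ) :
    ℕ → ℕ → Fin n → ℝ
  | 0, _ => 0
  | k + 1, j =>
      closedLoop A C γ (predCov A C Q γ P₀ k) *ᵥ predCoeff A C Q γ P₀ k j
        + if j = k then gain A C γ (predCov A C Q γ P₀ k) else 0

theorem predCoeff_of_le {k j : ℕ} (h : k ≤ j) : predCoeff A C Q γ P₀ k j = 0 := by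
  induction k with
  | zero => rfl
  | succ k ih => simp [predCoeff, ih (by omega), show j ≠ k by omega]

theorem predCoeff_succ_of_lt {k j : ℕ} (h : j < k) : predCoeff A C Q γ P₀ (k + 1) j =
    closedLoop A C γ (predCov A C Q γ P₀ k) *ᵥ predCoeff A C Q γ P₀ k j := by
  simp [predCoeff, h.ne]

theorem predCoeff_succ_self (k : ℕ) : predCoeff A C Q γ P₀ (k + 1) k =
    gain A C γ (predCov A C Q γ P₀ k) := by
  simp [predCoeff, predCoeff_of_le le_rfl]

/-- Old coefficients are propagated by the closed loop, and the newest one is the gain: exactly the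
recursion of `gcvSigma`. -/
theorem gcvSigma_eq_sum (k : ℕ) : gcvSigma A C Q γ P₀ k =
    ∑ j ∈ Finset.range k,
      vecMulVec (predCoeff A C Q γ P₀ k j) (predCoeff A C Q γ P₀ k j) := by
  induction k with
  | zero => rfl
  | succ k ih =>
    rw [gcvSigma, ih, Finset.sum_range_succ, predCoeff_succ_self, Matrix.mul_sum, Matrix.sum_mul]
    congr 1
    refine Finset.sum_congr rfl fun j hj => ?_
    rw [predCoeff_succ_of_lt (Finset.mem_range.1 hj), mul_vecMulVec, vecMulVec_mul,
      vecMul_transpose]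

/-- The covariances `S k l` of the states `x_k`, `x_l` of the state space model. -/
structure IsStateCov (A Q P₀ : Matrix (Fin n) (Fin n) ℝ)
    (S : ℕ → ℕ → Matrix (Fin n) (Fin n) ℝ) : Prop where
  init : S 0 0 = P₀
  symm : ∀ k l, (S k l)ᵀ = S l k
  step : ∀ k l, l ≤ k → S (k + 1) l = A * S k l
  diag : ∀ k, S (k + 1) (k + 1) = A * S k k * Aᵀ + Q

/-- The covariance of the outputs `y_k`, `y_l`. -/
def outCov (C : Fin n → ℝ) (γ : ℝ) (S : ℕ → ℕ → Matrix (Fin n) (Fin n) ℝ) (k l : ℕ) : ℝ :=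
  outputVar C (S k l) + if k = l then γ else 0

theorem outputVar_transpose (M : Matrix (Fin n) (Fin n) ℝ) : outputVar C Mᵀ = outputVar C M := by
  rw [outputVar, outputVar, mulVec_transpose, dotProduct_comm, dotProduct_mulVec]

theorem outCov_comm (hS : IsStateCov A Q P₀ S) (k l : ℕ) :
    outCov C γ S k l = outCov C γ S l k := by
  simp only [outCov, ← hS.symm k l, outputVar_transpose, eq_comm]

/-- The prediction error `x_k - x̂_k` has covariance `P_k` with `x_k`. -/
theorem cov_predictionError_state (hS : IsStateCov A Q P₀ S)
    (hd : ∀ k, outputVar C (predCov A C Q γ P₀ k) + γ ≠ 0) (k : ℕ) :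
    S k k - ∑ j ∈ Finset.range k, vecMulVec (predCoeff A C Q γ P₀ k j) (S k j *ᵥ C) =
      predCov A C Q γ P₀ k := by
  induction k with
  | zero => simpa [predCov] using hS.init
  | succ k ih =>
    have h1 : ∑ j ∈ Finset.range k,
        vecMulVec (predCoeff A C Q γ P₀ (k + 1) j) (S (k + 1) j *ᵥ C) =
        closedLoop A C γ (predCov A C Q γ P₀ k) *
          (∑ j ∈ Finset.range k, vecMulVec (predCoeff A C Q γ P₀ k j) (S k j *ᵥ C)) * Aᵀ := by
      rw [Matrix.mul_sum, Matrix.sum_mul]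
      refine Finset.sum_congr rfl fun j hj => ?_
      have hj' := Finset.mem_range.1 hj
      rw [predCoeff_succ_of_lt hj', hS.step k j hj'.le, mul_vecMulVec, vecMulVec_mul,
        vecMul_transpose, mulVec_mulVec]
    have h2 : vecMulVec (gain A C γ (predCov A C Q γ P₀ k)) (S (k + 1) k *ᵥ C) =
        vecMulVec (gain A C γ (predCov A C Q γ P₀ k)) C * S k k * Aᵀ := by
      rw [hS.step k k le_rfl, vecMulVec_mul, vecMulVec_mul, vecMul_transpose, ← mulVec_transpose,
        hS.symm, mulVec_mulVec]
    rw [predCov_succ, riccatiStep_eq (hd k), Finset.sum_range_succ, predCoeff_succ_self, h1, h2,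
      hS.diag, ← sub_sub_self (S k k) (∑ j ∈ Finset.range k, _), ih, closedLoop]
    noncomm_ring

/-- The covariance of the prediction error `x_k - x̂_k` with the output `y_l`. -/
noncomputable def errorOutCov (A : Matrix (Fin n) (Fin n) ℝ) (C : Fin n → ℝ)
    (Q : Matrix (Fin n) (Fin n) ℝ) (γ : ℝ) (P₀ : Matrix (Fin n) (Fin n) ℝ)
    (S : ℕ → ℕ → Matrix (Fin n) (Fin n) ℝ) (k l : ℕ) : Fin n → ℝ :=
  S k l *ᵥ C - ∑ j ∈ Finset.range k, outCov C γ S j l • predCoeff A C Q γ P₀ k j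

theorem errorOutCov_self (hS : IsStateCov A Q P₀ S)
    (hd : ∀ k, outputVar C (predCov A C Q γ P₀ k) + γ ≠ 0) (k : ℕ) :
    errorOutCov A C Q γ P₀ S k k = predCov A C Q γ P₀ k *ᵥ C := by
  rw [← cov_predictionError_state hS hd k, sub_mulVec, errorOutCov, sum_mulVec]
  congr 1
  refine Finset.sum_congr rfl fun j hj => ?_
  have hj' := Finset.mem_range.1 hj
  rw [outCov_comm hS, vecMulVec_mulVec, outCov, if_neg hj'.ne', add_zero, outputVar,
    dotProduct_comm]
  simp

/-- The prediction error is uncorrelated with the past outputs. -/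
theorem errorOutCov_of_lt (hS : IsStateCov A Q P₀ S)
    (hd : ∀ k, outputVar C (predCov A C Q γ P₀ k) + γ ≠ 0) {k l : ℕ} (h : l < k) :
    errorOutCov A C Q γ P₀ S k l = 0 := by
  induction k with
  | zero => omega
  | succ k ih =>
    have hl : l ≤ k := by omega
    set K := gain A C γ (predCov A C Q γ P₀ k) with hK
    have h1 : errorOutCov A C Q γ P₀ S (k + 1) l =
        closedLoop A C γ (predCov A C Q γ P₀ k) *ᵥ errorOutCov A C Q γ P₀ S k l
          - (if k = l then γ else 0) • K := by
      have h2 : ∑ j ∈ Finset.range k, outCov C γ S j l • predCoeff A C Q γ P₀ (k + 1) j =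
          closedLoop A C γ (predCov A C Q γ P₀ k) *ᵥ
            ∑ j ∈ Finset.range k, outCov C γ S j l • predCoeff A C Q γ P₀ k j := by
        rw [mulVec_sum]
        refine Finset.sum_congr rfl fun j hj => ?_
        rw [predCoeff_succ_of_lt (Finset.mem_range.1 hj), mulVec_smul]
      rw [errorOutCov, errorOutCov, Finset.sum_range_succ, h2, mulVec_sub, predCoeff_succ_self,
        hS.step k l hl, outCov, add_smul, ← hK]
      have h3 : closedLoop A C γ (predCov A C Q γ P₀ k) *ᵥ (S k l *ᵥ C) =
          (A * S k l) *ᵥ C - outputVar C (S k l) • K := by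
        rw [closedLoop, sub_mulVec, mulVec_mulVec, vecMulVec_mulVec, outputVar, ← hK]
        simp
      rw [h3]
      abel
    rw [h1]
    -- For `l < k` orthogonality is propagated; for the newest output the noise term `γ • K` cancels
    -- by `closedLoop_mul_mulVec`.
    rcases hl.lt_or_eq with hlt | rfl
    · rw [ih hlt, if_neg hlt.ne']
      simp
    · rw [errorOutCov_self hS hd, if_pos rfl, mulVec_mulVec, closedLoop_mul_mulVec (hd l), sub_self]

/-- The whitening matrix: its rows give the innovations in terms of the outputs. -/
noncomputable def whitening (A : Matrix (Fin n) (Fin n) ℝ) (C : Fin n → ℝ)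
    (Q : Matrix (Fin n) (Fin n) ℝ) (γ : ℝ) (P₀ : Matrix (Fin n) (Fin n) ℝ) (t : ℕ) :
    Matrix (Fin t) (Fin t) ℝ :=
  of fun k j => (if k = j then 1 else 0) - C ⬝ᵥ predCoeff A C Q γ P₀ k j

theorem sum_fin_mul_predCoeff {t : ℕ} (k : Fin t) (f : ℕ → ℝ → ℝ) (hf : ∀ j, f j 0 = 0) :
    ∑ j : Fin t, f j (C ⬝ᵥ predCoeff A C Q γ P₀ k j) =
      ∑ j ∈ Finset.range k, f j (C ⬝ᵥ predCoeff A C Q γ P₀ k j) := by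
  rw [Fin.sum_univ_eq_sum_range (fun j => f j (C ⬝ᵥ predCoeff A C Q γ P₀ k j)) t]
  refine (Finset.sum_subset (Finset.range_subset_range.2 k.2.le) fun j _ hj => ?_).symm
  rw [predCoeff_of_le (by simpa using hj), dotProduct_zero, hf]

theorem whitening_mul_apply (t : ℕ) (k l : Fin t) :
    (whitening A C Q γ P₀ t * of fun i j : Fin t => outCov C γ S i j) k l =
      C ⬝ᵥ errorOutCov A C Q γ P₀ S k l + if k = l then γ else 0 := by
  have h := sum_fin_mul_predCoeff (A := A) (C := C) (Q := Q) (γ := γ) (P₀ := P₀) k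
    (fun j c => c * outCov C γ S j l) (by simp)
  simp only [whitening, mul_apply, of_apply, sub_mul, Finset.sum_sub_distrib, h, ite_mul, one_mul,
    zero_mul, Finset.sum_ite_eq, Finset.mem_univ, if_true]
  rw [errorOutCov, dotProduct_sub, dotProduct_sum, outCov, outputVar]
  simp only [dotProduct_smul, smul_eq_mul, mul_comm, Fin.ext_iff]
  ring

/-- `W` is unit lower triangular, and `W * V` is upper triangular because prediction errors are
uncorrelated with past outputs. On and below the diagonal only one summand survives; symmetry gives
the rest. -/
theorem whitening_mul_mul_transpose (hS : IsStateCov A Q P₀ S)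
    (hd : ∀ k, outputVar C (predCov A C Q γ P₀ k) + γ ≠ 0) (t : ℕ) :
    whitening A C Q γ P₀ t * (of fun i j : Fin t => outCov C γ S i j)
        * (whitening A C Q γ P₀ t)ᵀ =
      diagonal fun k : Fin t => outputVar C (predCov A C Q γ P₀ k) + γ := by
  set W := whitening A C Q γ P₀ t with hW
  set V : Matrix (Fin t) (Fin t) ℝ := of fun i j : Fin t => outCov C γ S i j with hV
  have hVt : Vᵀ = V := by
    ext i j
    exact outCov_comm hS _ _
  have hsymm : (W * V * Wᵀ)ᵀ = W * V * Wᵀ := by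
    rw [transpose_mul, transpose_mul, transpose_transpose, hVt, Matrix.mul_assoc]
  have hWV : ∀ k l : Fin t, l < k → (W * V) k l = 0 := fun k l h => by
    rw [hW, whitening_mul_apply, errorOutCov_of_lt hS hd h, if_neg h.ne']
    simp
  have hW0 : ∀ k l : Fin t, k < l → W k l = 0 := fun k l h => by
    simp [hW, whitening, h.ne, predCoeff_of_le (Fin.lt_def.1 h).le]
  have hlower : ∀ k m : Fin t, m ≤ k → (W * V * Wᵀ) k m = (W * V) k k * W m k := by
    intro k m hmk
    rw [mul_apply]
    refine Finset.sum_eq_single k (fun l _ hlk => ?_) (by simp)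
    rcases lt_or_gt_of_ne hlk with h | h
    · rw [hWV k l h, zero_mul]
    · rw [transpose_apply, hW0 m l (hmk.trans_lt h), mul_zero]
  have hoff : ∀ k m : Fin t, m < k → (W * V * Wᵀ) k m = 0 := fun k m h => by
    rw [hlower k m h.le, hW0 m k h, mul_zero]
  ext k m
  rcases lt_trichotomy m k with h | rfl | h
  · rw [hoff k m h, diagonal_apply_ne _ h.ne']
  · rw [hlower m m le_rfl, diagonal_apply_eq, hW, whitening_mul_apply, errorOutCov_self hS hd,
      outputVar]
    simp [whitening, predCoeff_of_le le_rfl]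
  · rw [← hsymm, transpose_apply, hoff m k h, diagonal_apply_ne _ h.ne]

/-- The unit diagonal entry and the prediction coefficients have disjoint supports, so their squares
add without cross terms. -/
theorem sum_sq_whitening (t : ℕ) (k : Fin t) :
    ∑ j, whitening A C Q γ P₀ t k j ^ 2 = outputVar C (gcvSigma A C Q γ P₀ k) + 1 := by
  have h0 : ∀ j : Fin t, whitening A C Q γ P₀ t k j ^ 2 =
      (C ⬝ᵥ predCoeff A C Q γ P₀ k j) ^ 2 + if k = j then 1 else 0 := fun j => by
    by_cases h : k = j
    · subst h
      simp [whitening, predCoeff_of_le le_rfl]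
    · simp [whitening, h]
  have h1 := sum_fin_mul_predCoeff (A := A) (C := C) (Q := Q) (γ := γ) (P₀ := P₀) k
    (fun _ c => c ^ 2) (by simp)
  simp only [h0, Finset.sum_add_distrib, h1]
  rw [gcvSigma_eq_sum, outputVar, sum_mulVec, dotProduct_sum]
  simp [vecMulVec_mulVec, dotProduct_comm C, sq]

/-- The output covariance matrix is invertible and the trace of its inverse is the sum of the
normalized variances produced by the filter. -/
theorem isUnit_det_and_trace_inv (hS : IsStateCov A Q P₀ S)
    (hd : ∀ k, outputVar C (predCov A C Q γ P₀ k) + γ ≠ 0) (t : ℕ) :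
    IsUnit (of fun i j : Fin t => outCov C γ S i j).det ∧
    (of fun i j : Fin t => outCov C γ S i j)⁻¹.trace = ∑ k ∈ Finset.range t,
      (outputVar C (gcvSigma A C Q γ P₀ k) + 1) / (outputVar C (predCov A C Q γ P₀ k) + γ) := by
  have h := whitening_mul_mul_transpose hS hd t
  set W := whitening A C Q γ P₀ t with hW
  set V : Matrix (Fin t) (Fin t) ℝ := of fun i j : Fin t => outCov C γ S i j with hV
  set E : Matrix (Fin t) (Fin t) ℝ :=
    diagonal fun k : Fin t => (outputVar C (predCov A C Q γ P₀ k) + γ)⁻¹ with hE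
  have h1 : W * (V * (Wᵀ * E)) = 1 := by
    rw [← Matrix.mul_assoc, ← Matrix.mul_assoc, h, hE, diagonal_mul_diagonal]
    simp [hd]
  -- For square matrices a right inverse is a left inverse, so `W` can be moved to the far right.
  have h2 : V * (Wᵀ * E * W) = 1 := by
    rw [← Matrix.mul_assoc]
    exact mul_eq_one_comm.1 h1
  refine ⟨isUnit_det_of_right_inverse h2, ?_⟩
  rw [inv_eq_right_inv h2, Matrix.mul_assoc, trace_mul_comm, trace,
    ← Fin.sum_univ_eq_sum_range (fun k => (outputVar C (gcvSigma A C Q γ P₀ k) + 1) /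
      (outputVar C (predCov A C Q γ P₀ k) + γ)) t]
  refine Finset.sum_congr rfl fun k _ => ?_
  rw [← sum_sq_whitening t k, diag_apply, Matrix.mul_assoc, hE, diagonal_mul, mul_apply, ← hW,
    div_eq_inv_mul]
  simp [sq]

end Innovations

/-! ### Second moments of the state space model. -/

section Model
open Matrix

theorem covariance_congr_left {Ω : Type*} [MeasurableSpace Ω] {μ : Measure Ω} {X X' Z : Ω → ℝ}
    (h : X =ᵐ[μ] X') : cov[X, Z; μ] = cov[X', Z; μ] := by
  rw [covariance, covariance, integral_congr_ae h]
  refine integral_congr_ae ?_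
  filter_upwards [h] with s hs
  rw [hs]

theorem covariance_sum_mul_add_left {Ω ι : Type*} [Fintype ι] [MeasurableSpace Ω] {μ : Measure Ω}
    [IsProbabilityMeasure μ] {X : ι → Ω → ℝ} {Y Z : Ω → ℝ} (c : ι → ℝ)
    (hX : ∀ i, MemLp (X i) 2 μ) (hY : MemLp Y 2 μ) (hZ : MemLp Z 2 μ) :
    cov[fun s => ∑ i, c i * X i s + Y s, Z; μ] = ∑ i, c i * cov[X i, Z; μ] + cov[Y, Z; μ] := by
  have h1 : ∀ i, MemLp (fun s => c i * X i s) 2 μ := fun i => (hX i).const_mul (c i)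
  have h2 : MemLp (fun s => ∑ i, c i * X i s) 2 μ := memLp_finsetSum _ fun i _ => h1 i
  have h3 := covariance_add_left h2 hY hZ
  rw [covariance_fun_sum_left h1 hZ] at h3
  simp only [covariance_const_mul_left] at h3
  exact h3

variable {Ω : Type*} [MeasurableSpace Ω] {μ : Measure Ω} {n : ℕ}
  {A : Matrix (Fin n) (Fin n) ℝ} {C : Fin n → ℝ} {Q : Matrix (Fin n) (Fin n) ℝ} {γ : ℝ}
  {m : Fin n → ℝ} {P₀ : Matrix (Fin n) (Fin n) ℝ} {x w : ℕ → Ω → Fin n → ℝ} {e y : ℕ → Ω → ℝ}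

namespace IsStateSpaceModel

theorem state_apply (h : IsStateSpaceModel μ A C Q γ m P₀ x w e y) (k : ℕ) (i : Fin n) :
    (fun s => x (k + 1) s i) =ᵐ[μ] fun s => ∑ j, A i j * x k s j + w k s i := by
  filter_upwards [h.state k] with s hs
  rw [hs]
  rfl

theorem output_apply (h : IsStateSpaceModel μ A C Q γ m P₀ x w e y) (k : ℕ) :
    y k =ᵐ[μ] fun s => ∑ j, C j * x k s j + e k s := by
  filter_upwards [h.output k] with s hs
  rw [hs]
  rfl

theorem memLp_state (h : IsStateSpaceModel μ A C Q γ m P₀ x w e y) (k : ℕ) (i : Fin n) :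
    MemLp (fun s => x k s i) 2 μ := by
  induction k generalizing i with
  | zero => exact h.memLp_init i
  | succ k ih =>
    refine MemLp.ae_eq (h.state_apply k i).symm ?_
    exact (memLp_finsetSum _ fun j _ => (ih j).const_mul (A i j)).add (h.memLp_w k i)

theorem memLp_output (h : IsStateSpaceModel μ A C Q γ m P₀ x w e y) (k : ℕ) :
    MemLp (y k) 2 μ := by
  refine MemLp.ae_eq (h.output_apply k).symm ?_
  exact (memLp_finsetSum _ fun j _ => (h.memLp_state k j).const_mul (C j)).add (h.memLp_e k)

variable [IsProbabilityMeasure μ]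

theorem cov_state_succ (h : IsStateSpaceModel μ A C Q γ m P₀ x w e y) {Z : Ω → ℝ}
    (hZ : MemLp Z 2 μ) (k : ℕ) (i : Fin n) :
    cov[fun s => x (k + 1) s i, Z; μ] =
      ∑ j, A i j * cov[fun s => x k s j, Z; μ] + cov[fun s => w k s i, Z; μ] := by
  rw [covariance_congr_left (h.state_apply k i)]
  exact covariance_sum_mul_add_left _ (fun j => h.memLp_state k j) (h.memLp_w k i) hZ

theorem cov_output (h : IsStateSpaceModel μ A C Q γ m P₀ x w e y) {Z : Ω → ℝ}
    (hZ : MemLp Z 2 μ) (k : ℕ) :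
    cov[y k, Z; μ] = ∑ j, C j * cov[fun s => x k s j, Z; μ] + cov[e k, Z; μ] := by
  rw [covariance_congr_left (h.output_apply k)]
  exact covariance_sum_mul_add_left _ (fun j => h.memLp_state k j) (h.memLp_e k) hZ

/-- The state at index `k` is a linear combination of the initial state and the disturbances of
index `l < k`. -/
theorem cov_state_eq_zero (h : IsStateSpaceModel μ A C Q γ m P₀ x w e y) {Z : Ω → ℝ}
    (hZ : MemLp Z 2 μ) (h0 : ∀ i, cov[fun s => x 0 s i, Z; μ] = 0) {k : ℕ}
    (hw : ∀ l < k, ∀ i, cov[fun s => w l s i, Z; μ] = 0) (i : Fin n) :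
    cov[fun s => x k s i, Z; μ] = 0 := by
  induction k generalizing i with
  | zero => exact h0 i
  | succ k ih =>
    rw [h.cov_state_succ hZ, hw k k.lt_succ_self]
    simp [ih fun l hl => hw l (hl.trans k.lt_succ_self)]

theorem cov_state_noise (h : IsStateSpaceModel μ A C Q γ m P₀ x w e y) (k l : ℕ) (i : Fin n) :
    cov[fun s => x k s i, e l; μ] = 0 :=
  h.cov_state_eq_zero (h.memLp_e l) (h.uncorr_init_e l) (fun j _ => h.uncorr_w_e j l) i

theorem cov_state_disturbance (h : IsStateSpaceModel μ A C Q γ m P₀ x w e y) {k l : ℕ}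
    (hkl : k ≤ l) (i j : Fin n) : cov[fun s => x k s i, fun s => w l s j; μ] = 0 :=
  h.cov_state_eq_zero (h.memLp_w l j) (fun i => h.uncorr_init_w l i j)
    (fun p hp i => h.uncorr_w p l (hp.trans_le hkl).ne i j) i

theorem isStateCov (h : IsStateSpaceModel μ A C Q γ m P₀ x w e y) :
    IsStateCov A Q P₀ fun k l => of fun a b => cov[fun s => x k s a, fun s => x l s b; μ] := by
  have hsymm : ∀ k l, (of fun a b => cov[fun s => x k s a, fun s => x l s b; μ])ᵀ =
      of fun a b => cov[fun s => x l s a, fun s => x k s b; μ] := fun k l => by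
    ext a b
    exact covariance_comm _ _
  have hstep : ∀ k l, l ≤ k → (of fun a b => cov[fun s => x (k + 1) s a, fun s => x l s b; μ]) =
      A * of fun a b => cov[fun s => x k s a, fun s => x l s b; μ] := fun k l hl => by
    ext a b
    rw [of_apply, h.cov_state_succ (h.memLp_state l b), covariance_comm (fun s => w k s a),
      h.cov_state_disturbance hl, add_zero, mul_apply]
    rfl
  refine ⟨?_, hsymm, hstep, fun k => ?_⟩
  · ext a b
    exact h.cov_init a b
  · ext a b
    rw [of_apply, h.cov_state_succ (h.memLp_state (k + 1) b), covariance_comm (fun s => w k s a),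
      h.cov_state_succ (h.memLp_w k a), h.cov_w, ← h.cov_w k b a, covariance_comm, h.cov_w,
      Matrix.mul_assoc, ← hsymm k k, ← transpose_mul, ← hstep k k le_rfl, hsymm, Matrix.add_apply,
      mul_apply]
    simp [h.cov_state_disturbance le_rfl]

theorem cov_output_output (h : IsStateSpaceModel μ A C Q γ m P₀ x w e y) (k l : ℕ) :
    cov[y k, y l; μ] =
      outCov C γ (fun k l => of fun a b => cov[fun s => x k s a, fun s => x l s b; μ]) k l := by
  have he : cov[e k, y l; μ] = if k = l then γ else 0 := by
    rw [covariance_comm, h.cov_output (h.memLp_e k)]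
    simp only [h.cov_state_noise, mul_zero, Finset.sum_const_zero, zero_add]
    split_ifs with hkl
    · rw [hkl, h.cov_e]
    · exact h.uncorr_e l k (Ne.symm hkl)
  rw [h.cov_output (h.memLp_output l), he, outCov, outputVar, dotProduct]
  congr 1
  refine Finset.sum_congr rfl fun a _ => ?_
  rw [covariance_comm, h.cov_output (h.memLp_state k a), covariance_comm (e l),
    h.cov_state_noise, add_zero, mulVec, dotProduct]
  congr 1
  refine Finset.sum_congr rfl fun b _ => ?_
  rw [covariance_comm, of_apply, mul_comm]

theorem posSemidef_init (h : IsStateSpaceModel μ A C Q γ m P₀ x w e y) : P₀.PosSemidef := by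
  refine PosSemidef.of_dotProduct_mulVec_nonneg ?_ fun v => ?_
  · ext a b
    rw [conjTranspose_apply, star_trivial, ← h.cov_init, ← h.cov_init, covariance_comm]
  · have h1 : ∀ i, MemLp (fun s => v i * x 0 s i) 2 μ := fun i => (h.memLp_init i).const_mul (v i)
    have h2 : star v ⬝ᵥ P₀ *ᵥ v =
        cov[fun s => ∑ i, v i * x 0 s i, fun s => ∑ i, v i * x 0 s i; μ] := by
      rw [covariance_fun_sum_fun_sum h1 h1]
      simp only [covariance_const_mul_left, covariance_const_mul_right, h.cov_init, dotProduct,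
        mulVec, star_trivial, Finset.mul_sum]
      exact Finset.sum_congr rfl fun _ _ => Finset.sum_congr rfl fun _ _ => by ring
    rw [h2, covariance_self (memLp_finsetSum _ fun i _ => h1 i).aemeasurable]
    exact variance_nonneg _ _

theorem outputCov_eq (h : IsStateSpaceModel μ A C Q γ m P₀ x w e y) (t : ℕ) :
    outputCov μ y t = regressionMatrix C t * stateCov μ x t * (regressionMatrix C t)ᵀ
      + γ • 1 := by
  ext k l
  rw [outputCov, of_apply, h.cov_output_output, outCov, Matrix.add_apply, Matrix.smul_apply, one_apply]
  congr 1
  · simp only [mul_apply, transpose_apply, regressionMatrix, stateCov, of_apply,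
      Fintype.sum_prod_type, ite_mul, zero_mul, mul_ite, mul_zero, outputVar, dotProduct, mulVec]
    simp [Finset.sum_ite_irrel, Finset.mul_sum, Finset.sum_mul]
    rw [Finset.sum_comm]
    exact Finset.sum_congr rfl fun _ _ => Finset.sum_congr rfl fun _ _ => by ring
  · simp [Fin.ext_iff]

/-- The degrees of freedom in terms of the quantities propagated by the filter. -/
theorem degreesOfFreedom_eq (h : IsStateSpaceModel μ A C Q γ m P₀ x w e y)
    (hd : ∀ k, outputVar C (predCov A C Q γ P₀ k) + γ ≠ 0) (t : ℕ) :
    degreesOfFreedom μ C x y t = ∑ k ∈ Finset.range t,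
      (1 - γ * (outputVar C (gcvSigma A C Q γ P₀ k) + 1) /
        (outputVar C (predCov A C Q γ P₀ k) + γ)) := by
  have hV : outputCov μ y t = of fun i j : Fin t => outCov C γ
      (fun k l => of fun a b => cov[fun s => x k s a, fun s => x l s b; μ]) i j := by
    ext i j
    exact h.cov_output_output i j
  obtain ⟨hu, htr⟩ := isUnit_det_and_trace_inv h.isStateCov hd t
  rw [← hV] at hu htr
  have hH : influenceMatrix μ C x y t = 1 - γ • (outputCov μ y t)⁻¹ := by
    rw [influenceMatrix, eq_sub_of_add_eq (h.outputCov_eq t).symm, Matrix.sub_mul, mul_nonsing_inv _ hu, smul_mul_assoc, Matrix.one_mul]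
  rw [degreesOfFreedom, hH, trace_sub, trace_smul, htr, trace_one, Finset.sum_sub_distrib]
  simp [Finset.mul_sum, mul_div_assoc]

end IsStateSpaceModel

end Model

end GCVFilter

/-! ### Assembly of the limits. -/

theorem mainTheorem3 {Ω : Type*} [MeasurableSpace Ω] (μ : Measure Ω) [IsProbabilityMeasure μ]
    {n : ℕ} (A : Matrix (Fin n) (Fin n) ℝ) (C : Fin n → ℝ) (Q : Matrix (Fin n) (Fin n) ℝ)
    (γ : ℝ) (hγ : 0 < γ) (m : Fin n → ℝ) (P₀ : Matrix (Fin n) (Fin n) ℝ)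
    (x w : ℕ → Ω → Fin n → ℝ) (e y : ℕ → Ω → ℝ)
    (hmodel : GCVFilter.IsStateSpaceModel μ A C Q γ m P₀ x w e y)
    (hstab : ∃ B : Matrix (Fin n) (Fin n) ℝ, B * Bᵀ = Q ∧ GCVFilter.Stabilizable A B)
    (hdet : GCVFilter.Detectable A C) :
    ∃ Pbar Sbar : Matrix (Fin n) (Fin n) ℝ,
      (GCVFilter.IsRiccatiSolution A C Q γ Pbar ∧
        ∀ P, GCVFilter.IsRiccatiSolution A C Q γ P → P = Pbar) ∧
      (GCVFilter.IsLyapunovSolution A C γ Pbar Sbar ∧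
        ∀ S, GCVFilter.IsLyapunovSolution A C γ Pbar S → S = Sbar) ∧
      Tendsto (GCVFilter.predCov A C Q γ P₀) atTop (𝓝 Pbar) ∧
      Tendsto (GCVFilter.gcvSigma A C Q γ P₀) atTop (𝓝 Sbar) ∧
      Tendsto (fun k : ℕ => GCVFilter.degreesOfFreedom μ C x y k / (k : ℝ)) atTop
        (𝓝 (1 - γ * (GCVFilter.outputVar C Sbar + 1) / (GCVFilter.outputVar C Pbar + γ))) := by
  open GCVFilter MatrixOrder in
  obtain ⟨B, hB, hst⟩ := hstab
  have hQ : 0 ≤ Q := by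
    rw [Matrix.nonneg_iff_posSemidef, ← hB, ← Matrix.conjTranspose_eq_transpose_of_trivial]
    exact Matrix.posSemidef_self_mul_conjTranspose B
  have hP₀ : 0 ≤ P₀ := Matrix.nonneg_iff_posSemidef.2 hmodel.posSemidef_init
  obtain ⟨L, hL0, hfix, hL⟩ := exists_riccati_tendsto (A := A) (C := C) hγ hQ hdet
  have hF := schurStable_closedLoop hγ hB hst (Matrix.nonneg_iff_posSemidef.1 hL0) hfix
  have hattr : ∀ P, 0 ≤ P → Tendsto (predCov A C Q γ P) atTop (𝓝 L) := fun P hP =>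
    tendsto_predCov hγ hQ hL0 hfix hL hF hP
  obtain ⟨S, hS0, hS⟩ := exists_lyapunov hF
    (Matrix.nonneg_iff_posSemidef.1 (vecMulVec_self_nonneg (gain A C γ L)))
  have hdL := (outputVar_add_pos (C := C) hγ hL0).ne'
  have hPlim := hattr P₀ hP₀
  have hKlim := (continuousAt_gain (A := A) hdL).tendsto.comp hPlim
  have hSlim : Tendsto (gcvSigma A C Q γ P₀) atTop (𝓝 S) :=
    tendsto_lyapunov_recursion hF hS ((continuousAt_closedLoop (A := A) hdL).tendsto.comp hPlim)
      ((continuous_vecMulVec.tendsto _).comp (hKlim.prodMk_nhds hKlim)) fun _ => rfl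
  refine ⟨L, S, ⟨(isRiccatiSolution_iff hγ).2 ⟨hL0, hfix⟩, fun P hP => ?_⟩,
    ⟨⟨hS0, hS⟩, fun S' hS' => lyapunov_unique hF hS hS'.2⟩, hPlim, hSlim, ?_⟩
  -- Any solution is a constant Riccati trajectory, and every trajectory tends to `L`.
  · obtain ⟨hP0, hPfix⟩ := (isRiccatiSolution_iff hγ).1 hP
    have hconst : ∀ k, predCov A C Q γ P k = P := fun k => by
      induction k with
      | zero => rfl
      | succ k ih => rw [predCov_succ, ih, hPfix]
    exact tendsto_nhds_unique (tendsto_const_nhds.congr fun k => (hconst k).symm) (hattr P hP0)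
  · have hd : ∀ k, outputVar C (predCov A C Q γ P₀ k) + γ ≠ 0 := fun k =>
      (outputVar_add_pos hγ (predCov_nonneg hγ hQ hP₀ k)).ne'
    have hterm : Tendsto (fun k => 1 - γ * (outputVar C (gcvSigma A C Q γ P₀ k) + 1) /
        (outputVar C (predCov A C Q γ P₀ k) + γ)) atTop
        (𝓝 (1 - γ * (outputVar C S + 1) / (outputVar C L + γ))) :=
      tendsto_const_nhds.sub ((((continuous_outputVar.tendsto S).comp hSlim).add_const 1
        |>.const_mul γ).div (((continuous_outputVar.tendsto L).comp hPlim).add_const γ) hdL)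
    refine hterm.cesaro.congr fun k => ?_
    rw [hmodel.degreesOfFreedom_eq hd, div_eq_inv_mul]
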